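/- Let $N$, $d\ge 2$ and $m$ be integers with $2\le m\le [N/2]$, and let $\ell>0$. An $N$-gon in $\mathbb{R}^d$ is a tuple $y=(y_j)_{j\in\mathbb{Z}/N\mathbb{Z}}$ of points of $\mathbb{R}^d$ (its vertices); it is equilateral with edge length $\ell$ if $|y_{j+1}-y_j|=\ell$ for all $j$. Its $m$-diagonals are the segments joining $y_j$ and $y_{j+m}$, indexed by the unordered pairs $\{j,j+m\}$ (there are $N$ of them if $m<N/2$, and $N/2$ if $m=N/2$), and $\mathcal{D}_m(y)$ is the sum of their lengths. A regular $N$-gon of edge length $\ell$ is an $N$-gon $\tilde y$ with $$\tilde y_j=c+\frac{\ell}{2\sin\frac{\pi}{N}}\left(\cos\frac{2\pi j}{N}\,u+\sin\frac{2\pi j}{N}\,v\right)$$ for some $c\in\mathbb{R}^d$ and some orthonormal $u,v\in\mathbb{R}^d$. Then among equilateral $N$-gons of edge length $\ell$, $\mathcal{D}_m$ has at every regular $N$-gon $\tilde y$ a local maximum that is strict up to Euclidean transformations: $\tilde y$ is equilateral with edge length $\ell$, and there is a neighbourhood $U$ of $\tilde y$ in $(\mathbb{R}^d)^N$ such that every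 equilateral $y\in U$ with edge length $\ell$ satisfies $\mathcal{D}_m(y)\le\mathcal{D}_m(\tilde y)$, with equality if and only if there is an isometry $T$ of $\mathbb{R}^d$ with $y_j=T\tilde y_j$ for all $j$. -/

import Mathlib

open scoped Topology

noncomputable section

/-- A closed polygon with `N` vertices in `ℝ^d` is the family of its vertices, with indices
understood modulo `N`. It is equilateral with edge length `ℓ` if all its edges have
length `ℓ`. -/
def IsEquilateral {N d : ℕ} (ℓ : ℝ) (y : ZMod N → EuclideanSpace ℝ (Fin d)) : Prop :=
  ∀ j : ZMod N, dist (y (j + 1)) (y j) = ℓ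

/-- A regular `N`-gon of edge length `ℓ` in `ℝ^d`: it lies in a two-dimensional plane (spanned,
from the center `c`, by the orthonormal pair `u`, `v`), and its vertices lie, consecutively and
equally spaced, on a circle of radius `ℓ / (2 sin (π / N))`, going around that circle once. -/
def IsRegularPolygon {N d : ℕ} (ℓ : ℝ) (y : ZMod N → EuclideanSpace ℝ (Fin d)) : Prop :=
  ∃ c u v : EuclideanSpace ℝ (Fin d),
    ‖u‖ = 1 ∧ ‖v‖ = 1 ∧ inner ℝ u v = 0 ∧
    ∀ j : ZMod N,
      y j = c + (ℓ / (2 * Real.sin (Real.pi / N))) •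
        (Real.cos (2 * Real.pi * (j.val : ℝ) / N) • u +
          Real.sin (2 * Real.pi * (j.val : ℝ) / N) • v)

/-- The `m`-diagonals of an `N`-gon, as unordered pairs of vertex indices `{j, j + m}`. In
particular each of them occurs once, also when `N = 2 * m`. -/
def mDiagonals (N m : ℕ) [NeZero N] : Finset (Sym2 (ZMod N)) :=
  Finset.univ.image fun j : ZMod N => s(j, j + (m : ZMod N))

/-- The length of the segment joining the two vertices of an unordered pair of indices. -/
def segmentLength {N d : ℕ} (y : ZMod N → EuclideanSpace ℝ (Fin d)) : Sym2 (ZMod N) → ℝ :=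
  Sym2.lift ⟨fun i j => dist (y i) (y j), fun i j => dist_comm (y i) (y j)⟩

/-- The sum `D_m` of the lengths of all `m`-diagonals of a polygon. -/
def diagonalSum {N d : ℕ} [NeZero N] (m : ℕ) (y : ZMod N → EuclideanSpace ℝ (Fin d)) : ℝ :=
  ∑ e ∈ mDiagonals N m, segmentLength y e

/-- Two polygons are congruent if a Euclidean transformation of `ℝ^d` (a bijective isometry) maps
the vertices of the first to the corresponding vertices of the second. -/
def AreCongruent {N d : ℕ} (y z : ZMod N → EuclideanSpace ℝ (Fin d)) : Prop :=
  ∃ T : EuclideanSpace ℝ (Fin d) ≃ᵢ EuclideanSpace ℝ (Fin d), ∀ j : ZMod N, T (y j) = z j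

end

/-! The maximum is in fact global. Apply the discrete Fourier transform to each coordinate: by
Parseval, frequency `k` contributes to the sum of squared `m`-diagonals and to the sum of squared
edges in the ratio `(sin (m k π / N) / sin (k π / N)) ^ 2`, which for `k ≠ 0` is largest exactly at
`k = ±1` (`sin_sq_mul_sin_sq_le_val`). As the edges are fixed, this bounds the quadratic mean of the
`m`-diagonals by their common length `D` in the regular polygon, hence also their arithmetic mean
(`sum_le_card_mul_of_sum_sq_le`).

If equality holds, every `m`-diagonal equals `D` and only the frequencies `0, ±1` survive, so the
polygon is an affine image of a regular one, inscribed in a possibly degenerate ellipse. Constant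
edges and constant `m`-diagonals force a circle (`eq_of_quadratic_form_on_angles`), and regular
polygons of equal edge length are congruent. -/

open scoped ZMod

/-! ### Inequalities for sine ratios -/

/-- On `(0, π / m]` the ratio `sin (m x) / sin x` is antitone (cross-multiplied form). -/
theorem sin_nat_mul_mul_sin_le {s x : ℝ} (hs : 0 < s) (hsx : s ≤ x) (hx : x ≤ Real.pi / 2)
    (n : ℕ) (hn : 1 ≤ n) (hnx : n * x ≤ Real.pi) :
    Real.sin (n * x) * Real.sin s ≤ Real.sin x * Real.sin (n * s) := by
  induction n, hn using Nat.le_induction with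
  | base => simp
  | succ n hn ih =>
    push_cast at hnx ⊢
    have hn0 : (0 : ℝ) ≤ n := n.cast_nonneg
    have hns : (n : ℝ) * s ≤ n * x := mul_le_mul_of_nonneg_left hsx hn0
    have ih' := ih (by linarith)
    have h1 : Real.cos x ≤ Real.cos s :=
      Real.cos_le_cos_of_nonneg_of_le_pi hs.le (by linarith [Real.pi_pos]) hsx
    have h2 : Real.cos (n * x) ≤ Real.cos (n * s) :=
      Real.cos_le_cos_of_nonneg_of_le_pi (by positivity) (by linarith) hns
    have h3 : 0 ≤ Real.cos x := Real.cos_nonneg_of_neg_pi_div_two_le_of_le (by linarith) hx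
    have h4 : 0 ≤ Real.sin x := Real.sin_nonneg_of_nonneg_of_le_pi (by linarith) (by linarith)
    have h5 : 0 ≤ Real.sin s := Real.sin_nonneg_of_nonneg_of_le_pi (by linarith) (by linarith)
    have h6 : 0 ≤ Real.sin (n * s) :=
      Real.sin_nonneg_of_nonneg_of_le_pi (by positivity) (by linarith)
    rw [add_one_mul, add_one_mul, Real.sin_add, Real.sin_add]
    have e1 := mul_le_mul ih' h1 h3 (by positivity)
    have e2 := mul_le_mul_of_nonneg_right h2 (mul_nonneg h4 h5)
    linarith

theorem sin_nat_mul_mul_sin_lt {s x : ℝ} (hs : 0 < s) (hsx : s < x) (hx : x ≤ Real.pi / 2)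
    (n : ℕ) (hn : 2 ≤ n) (hnx : n * x ≤ Real.pi) :
    Real.sin (n * x) * Real.sin s < Real.sin x * Real.sin (n * s) := by
  obtain ⟨k, rfl⟩ : ∃ k, n = k + 1 := ⟨n - 1, by omega⟩
  have hk : 1 ≤ k := by omega
  -- The induction step once more; strictness comes from `cos (k x) < cos (k s)`, which needs `k ≥
  -- 1`.
  push_cast at hnx ⊢
  have hk0 : (0 : ℝ) < k := by exact_mod_cast hk
  have hks : (k : ℝ) * s < k * x := mul_lt_mul_of_pos_left hsx hk0
  have ih := sin_nat_mul_mul_sin_le hs hsx.le hx k hk (by linarith)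
  have h1 : Real.cos x ≤ Real.cos s :=
    Real.cos_le_cos_of_nonneg_of_le_pi hs.le (by linarith [Real.pi_pos]) hsx.le
  have h2 : Real.cos (k * x) < Real.cos (k * s) :=
    Real.cos_lt_cos_of_nonneg_of_le_pi (by positivity) (by linarith) hks
  have h3 : 0 ≤ Real.cos x := Real.cos_nonneg_of_neg_pi_div_two_le_of_le (by linarith) hx
  have h4 : 0 < Real.sin x := Real.sin_pos_of_pos_of_lt_pi (by linarith) (by linarith)
  have h5 : 0 < Real.sin s := Real.sin_pos_of_pos_of_lt_pi (by linarith) (by linarith)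
  have h6 : 0 ≤ Real.sin (k * s) :=
    Real.sin_nonneg_of_nonneg_of_le_pi (by positivity) (by linarith)
  rw [add_one_mul, add_one_mul, Real.sin_add, Real.sin_add]
  have e1 := mul_le_mul ih h1 h3 (by positivity)
  have e2 := mul_lt_mul_of_pos_right h2 (mul_pos h4 h5)
  linarith

/-- Past `n x = π` the monotonicity argument fails. There the numerator is bounded by `1`, its value
at `z = π / (2 n)`, while `sin z < sin x`; the comparison of `s` with `z` finishes. -/
theorem abs_sin_nat_mul_mul_sin_lt {s x : ℝ} (hs : 0 < s) (hsx : s < x) (hx : x ≤ Real.pi / 2)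
    (n : ℕ) (hn : 2 ≤ n) (hns : n * s ≤ Real.pi / 2) :
    |Real.sin (n * x)| * Real.sin s < Real.sin x * Real.sin (n * s) := by
  have hn0 : (2 : ℝ) ≤ n := by exact_mod_cast hn
  by_cases hnx : n * x ≤ Real.pi
  · rw [abs_of_nonneg (Real.sin_nonneg_of_nonneg_of_le_pi
      (mul_nonneg (by linarith) (by linarith)) hnx)]
    exact sin_nat_mul_mul_sin_lt hs hsx hx n hn hnx
  · push Not at hnx
    have hpi := Real.pi_pos
    have hn1 : (0 : ℝ) < n := by linarith
    set z : ℝ := Real.pi / 2 / n with hz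
    have hnz : n * z = Real.pi / 2 := by rw [hz]; field_simp
    have hsz : s ≤ z := by rw [hz, le_div_iff₀ hn1]; linarith
    have hzx : z < x := by rw [hz, div_lt_iff₀ hn1]; linarith
    have h := sin_nat_mul_mul_sin_le hs hsz (by linarith) n (by omega) (by linarith)
    rw [hnz, Real.sin_pi_div_two, one_mul] at h
    have h5 : 0 < Real.sin s := Real.sin_pos_of_pos_of_lt_pi hs (by linarith)
    have h6 : 0 < Real.sin (n * s) := Real.sin_pos_of_pos_of_lt_pi (by positivity) (by linarith)
    have h7 : Real.sin z < Real.sin x :=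
      Real.sin_lt_sin_of_lt_of_le_pi_div_two (by linarith) hx hzx
    calc |Real.sin (n * x)| * Real.sin s ≤ 1 * Real.sin s :=
          mul_le_mul_of_nonneg_right (Real.abs_sin_le_one _) h5.le
      _ ≤ Real.sin z * Real.sin (n * s) := by linarith
      _ < _ := mul_lt_mul_of_pos_right h7 h6

/-- Among the multiples `k π / N`, `2 ≤ k ≤ N - 2`, the ratio `|sin (m x) / sin x|` stays below its
value at `π / N`. -/
theorem sin_sq_mul_sin_sq_lt {N m k : ℕ} (hm : 2 ≤ m) (hmN : 2 * m ≤ N) (hk : 2 ≤ k)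
    (hkN : k + 2 ≤ N) :
    Real.sin (m * (k * (Real.pi / N))) ^ 2 * Real.sin (Real.pi / N) ^ 2 <
      Real.sin (k * (Real.pi / N)) ^ 2 * Real.sin (m * (Real.pi / N)) ^ 2 := by
  have hN : (0 : ℝ) < N := by exact_mod_cast (by omega : 0 < N)
  have hpi := Real.pi_pos
  have hs : 0 < Real.pi / N := by positivity
  have hNs : (N : ℝ) * (Real.pi / N) = Real.pi := by field_simp
  have hms : (m : ℝ) * (Real.pi / N) ≤ Real.pi / 2 := by
    have : (2 * m : ℝ) ≤ N := by exact_mod_cast hmN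
    nlinarith
  have key : ∀ q : ℕ, 2 ≤ q → 2 * q ≤ N →
      Real.sin (m * (q * (Real.pi / N))) ^ 2 * Real.sin (Real.pi / N) ^ 2 <
        Real.sin (q * (Real.pi / N)) ^ 2 * Real.sin (m * (Real.pi / N)) ^ 2 := by
    intro q hq hqN
    have hq2 : (2 : ℝ) ≤ q := by exact_mod_cast hq
    have hqN' : (2 * q : ℝ) ≤ N := by exact_mod_cast hqN
    have h := abs_sin_nat_mul_mul_sin_lt hs (x := q * (Real.pi / N)) (by nlinarith)
      (by nlinarith) m hm hms
    have h5 : 0 ≤ Real.sin (Real.pi / N) :=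
      Real.sin_nonneg_of_nonneg_of_le_pi hs.le (by nlinarith)
    have := pow_lt_pow_left₀ h (mul_nonneg (abs_nonneg _) h5) two_ne_zero
    simpa only [mul_pow, sq_abs] using this
  by_cases h : 2 * k ≤ N
  · exact key k hk h
  -- The reflection `k ↦ N - k` leaves both squared sines unchanged.
  · have := key (N - k) (by omega) (by omega)
    rw [Nat.cast_sub (by omega), sub_mul, hNs, mul_sub, Real.sin_pi_sub, Real.sin_nat_mul_pi_sub,
      neg_sq, mul_pow, ← pow_mul, mul_comm m 2, pow_mul, neg_one_sq, one_pow, one_mul] at this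
    exact this

/-! ### Discrete Fourier analysis -/

theorem ZMod.sum_norm_sq_dft {N : ℕ} [NeZero N] (g : ZMod N → ℂ) :
    ∑ k, ‖𝓕 g k‖ ^ 2 = N * ∑ j, ‖g j‖ ^ 2 := by
  have hN : (N : ℂ) ≠ 0 := NeZero.ne _
  have inv (j : ZMod N) : ∑ k, ZMod.stdAddChar (j * k) * 𝓕 g k = N * g j := by
    have h := congrFun (LinearEquiv.symm_apply_apply ZMod.dft g) j
    rw [ZMod.invDFT_apply] at h
    rw [← h]
    simp only [smul_eq_mul, mul_comm j]
    field_simp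
  have h : ∑ k, (starRingEnd ℂ) (𝓕 g k) * 𝓕 g k = N * ∑ j, (starRingEnd ℂ) (g j) * g j := by
    calc ∑ k, (starRingEnd ℂ) (𝓕 g k) * 𝓕 g k
        = ∑ k, ∑ j, (starRingEnd ℂ) (g j) * (ZMod.stdAddChar (j * k) * 𝓕 g k) := by
          refine Finset.sum_congr rfl fun k _ => ?_
          nth_rewrite 1 [ZMod.dft_apply]
          rw [map_sum, Finset.sum_mul]
          refine Finset.sum_congr rfl fun j _ => ?_
          rw [smul_eq_mul, map_mul, ← AddChar.map_neg_eq_conj, neg_neg]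
          ring
      _ = _ := by
          rw [Finset.sum_comm, Finset.mul_sum]
          refine Finset.sum_congr rfl fun j _ => ?_
          rw [← Finset.mul_sum, inv]
          ring
  simp only [Complex.conj_mul'] at h
  exact_mod_cast h

theorem ZMod.dft_comp_add_right {N : ℕ} [NeZero N] (g : ZMod N → ℂ) (a k : ZMod N) :
    𝓕 (fun j => g (j + a)) k = ZMod.stdAddChar (a * k) * 𝓕 g k := by
  rw [ZMod.dft_apply, ZMod.dft_apply, Finset.mul_sum]
  refine Fintype.sum_equiv (Equiv.addRight a) _ _ fun j => ?_
  simp only [Equiv.coe_addRight, smul_eq_mul]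
  rw [← mul_assoc, ← AddChar.map_add_eq_mul]
  congr 2
  ring

theorem ZMod.norm_stdAddChar_sub_one_sq {N : ℕ} [NeZero N] (a : ℕ) (k : ZMod N) :
    ‖ZMod.stdAddChar ((a : ZMod N) * k) - 1‖ ^ 2 =
      4 * Real.sin (a * (k.val * (Real.pi / N))) ^ 2 := by
  have h : (a : ZMod N) * k = ((a * k.val : ℕ) : ℤ) := by
    push_cast
    rw [ZMod.natCast_zmod_val]
  rw [h, ZMod.stdAddChar_coe]
  have h2 : 2 * Real.pi * Complex.I * (((a * k.val : ℕ) : ℤ) : ℂ) / N =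
      Complex.I * ((2 * (a * (k.val * (Real.pi / N))) : ℝ) : ℂ) := by
    push_cast
    ring
  rw [h2, Complex.norm_exp_I_mul_ofReal_sub_one, Real.norm_eq_abs, sq_abs,
    mul_div_cancel_left₀ _ two_ne_zero]
  ring

/-- Parseval's identity for the differences of a sequence. -/
theorem sum_sq_sub_eq_sum_dft {N : ℕ} [NeZero N] (f : ZMod N → ℝ) (a : ℕ) :
    N * ∑ j : ZMod N, (f (j + (a : ZMod N)) - f j) ^ 2 =
      ∑ k : ZMod N, 4 * Real.sin (a * (k.val * (Real.pi / N))) ^ 2 *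
        ‖𝓕 (fun j => (f j : ℂ)) k‖ ^ 2 := by
  have h := ZMod.sum_norm_sq_dft (fun j => (f (j + (a : ZMod N)) : ℂ) - f j)
  have h1 : ∀ j, ‖(f (j + (a : ZMod N)) : ℂ) - f j‖ ^ 2 = (f (j + (a : ZMod N)) - f j) ^ 2 := fun j => by
    rw [← Complex.ofReal_sub, Complex.norm_real, Real.norm_eq_abs, sq_abs]
  simp only [h1] at h
  rw [← h]
  refine Finset.sum_congr rfl fun k _ => ?_
  have h2 : (fun j => (f (j + (a : ZMod N)) : ℂ) - f j) =
      (fun j => (f (j + (a : ZMod N)) : ℂ)) - fun j => (f j : ℂ) := rfl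
  rw [h2, map_sub, Pi.sub_apply, ZMod.dft_comp_add_right (fun i => (f i : ℂ)), ← sub_one_mul, norm_mul, mul_pow,
    ZMod.norm_stdAddChar_sub_one_sq]

theorem sin_sq_mul_sin_sq_le_val {N m : ℕ} [NeZero N] (hm : 2 ≤ m) (hmN : 2 * m ≤ N)
    (k : ZMod N) :
    Real.sin (m * (k.val * (Real.pi / N))) ^ 2 * Real.sin (Real.pi / N) ^ 2 ≤
      Real.sin (k.val * (Real.pi / N)) ^ 2 * Real.sin (m * (Real.pi / N)) ^ 2 ∧
    (k ≠ 0 → k ≠ 1 → k ≠ -1 →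
      Real.sin (m * (k.val * (Real.pi / N))) ^ 2 * Real.sin (Real.pi / N) ^ 2 <
      Real.sin (k.val * (Real.pi / N)) ^ 2 * Real.sin (m * (Real.pi / N)) ^ 2) := by
  have hN : (N : ℝ) ≠ 0 := NeZero.ne _
  have hk := ZMod.natCast_zmod_val k
  have hlt := ZMod.val_lt k
  have hstrict : k ≠ 0 → k ≠ 1 → k ≠ -1 → 2 ≤ k.val ∧ k.val + 2 ≤ N := by
    intro h0 h1 h2
    have h0' : k.val ≠ 0 := fun h => h0 (by rw [← hk, h, Nat.cast_zero])
    have h1' : k.val ≠ 1 := fun h => h1 (by rw [← hk, h, Nat.cast_one])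
    have h2' : k.val + 1 ≠ N := fun h => h2 <| by
      rw [eq_neg_iff_add_eq_zero, ← hk, ← Nat.cast_one (R := ZMod N), ← Nat.cast_add, h,
        ZMod.natCast_self]
    omega
  refine ⟨?_, fun h0 h1 h2 => ?_⟩
  · by_cases h0 : k.val = 0
    · simp [h0]
    by_cases h1 : k.val = 1
    · simp [h1, mul_comm]
    by_cases h2 : k.val + 1 = N
    · have : (k.val : ℝ) * (Real.pi / N) = Real.pi - Real.pi / N := by
        have : (k.val : ℝ) + 1 = N := by exact_mod_cast h2
        rw [eq_sub_of_add_eq this]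
        field_simp
      rw [this, mul_sub, Real.sin_nat_mul_pi_sub, Real.sin_pi_sub, neg_sq, mul_pow, ← pow_mul,
        mul_comm m 2, pow_mul, neg_one_sq, one_pow, one_mul, mul_comm]
    · exact (sin_sq_mul_sin_sq_lt hm hmN (by omega) (by omega)).le
  · exact sin_sq_mul_sin_sq_lt hm hmN (hstrict h0 h1 h2).1 (hstrict h0 h1 h2).2

theorem sum_sq_diagonal_le {N m : ℕ} [NeZero N] (hm : 2 ≤ m) (hmN : 2 * m ≤ N)
    (f : ZMod N → ℝ) :
    Real.sin (Real.pi / N) ^ 2 * ∑ j, (f (j + (m : ZMod N)) - f j) ^ 2 ≤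
      Real.sin (m * (Real.pi / N)) ^ 2 * ∑ j, (f (j + 1) - f j) ^ 2 ∧
    (Real.sin (Real.pi / N) ^ 2 * ∑ j, (f (j + (m : ZMod N)) - f j) ^ 2 =
      Real.sin (m * (Real.pi / N)) ^ 2 * ∑ j, (f (j + 1) - f j) ^ 2 →
      ∀ k : ZMod N, k ≠ 0 → k ≠ 1 → k ≠ -1 → 𝓕 (fun j => (f j : ℂ)) k = 0) := by
  have hN : (0 : ℝ) < N := by exact_mod_cast NeZero.pos N
  have e1 := sum_sq_sub_eq_sum_dft f 1
  have em := sum_sq_sub_eq_sum_dft f m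
  simp only [Nat.cast_one, one_mul] at e1
  set F := 𝓕 (fun j => (f j : ℂ)) with hF
  have hterm : ∀ k ∈ Finset.univ, Real.sin (Real.pi / N) ^ 2 *
      (4 * Real.sin (m * (k.val * (Real.pi / N))) ^ 2 * ‖F k‖ ^ 2) ≤
      Real.sin (m * (Real.pi / N)) ^ 2 *
      (4 * Real.sin (k.val * (Real.pi / N)) ^ 2 * ‖F k‖ ^ 2) := fun k _ => by
    have := mul_le_mul_of_nonneg_right (sin_sq_mul_sin_sq_le_val hm hmN k).1
      (by positivity : 0 ≤ 4 * ‖F k‖ ^ 2)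
    linarith
  refine ⟨?_, fun heq k h0 h1 h2 => ?_⟩
  · have := Finset.sum_le_sum hterm
    rw [← Finset.mul_sum, ← Finset.mul_sum, ← e1, ← em] at this
    refine le_of_mul_le_mul_left ?_ hN
    linarith
  · have hsum : ∑ k : ZMod N, Real.sin (Real.pi / N) ^ 2 *
        (4 * Real.sin (m * (k.val * (Real.pi / N))) ^ 2 * ‖F k‖ ^ 2) =
        ∑ k : ZMod N, Real.sin (m * (Real.pi / N)) ^ 2 *
        (4 * Real.sin (k.val * (Real.pi / N)) ^ 2 * ‖F k‖ ^ 2) := by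
      rw [← Finset.mul_sum, ← Finset.mul_sum, ← e1, ← em]
      linear_combination (N : ℝ) * heq
    have hk := (Finset.sum_eq_sum_iff_of_le hterm).1 hsum k (Finset.mem_univ k)
    by_contra hne
    have hpos : 0 < 4 * ‖F k‖ ^ 2 := by
      have := norm_pos_iff.2 hne
      positivity
    have := mul_lt_mul_of_pos_right ((sin_sq_mul_sin_sq_le_val hm hmN k).2 h0 h1 h2) hpos
    linarith

/-- A real sequence with frequencies `0`, `1`, `-1` only is a trigonometric polynomial of degree
one. -/
theorem exists_eq_add_cos_add_sin {N : ℕ} [NeZero N] (hN : 3 ≤ N) (f : ZMod N → ℝ)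
    (hf : ∀ k : ZMod N, k ≠ 0 → k ≠ 1 → k ≠ -1 → 𝓕 (fun j => (f j : ℂ)) k = 0) :
    ∃ c a b : ℝ, ∀ j : ZMod N, f j = c + Real.cos (2 * Real.pi * (j.val : ℝ) / N) * a +
      Real.sin (2 * Real.pi * (j.val : ℝ) / N) * b := by
  set F := 𝓕 (fun j => (f j : ℂ)) with hF
  -- For `N ≥ 3` the frequencies `0, 1, -1` are distinct, so Fourier inversion has exactly three
  -- terms.
  have h01 : (0 : ZMod N) ≠ 1 := by
    have : Fact (1 < N) := ⟨by omega⟩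
    exact zero_ne_one
  have h11 : (1 : ZMod N) ≠ -1 := by
    have : Fact (2 < N) := ⟨by omega⟩
    exact (ZMod.neg_one_ne_one).symm
  have h0n : (0 : ZMod N) ≠ -1 := fun h => h01 (by rw [zero_eq_neg] at h; exact h.symm)
  have key (j : ZMod N) : (f j : ℂ) =
      (N : ℂ)⁻¹ * (F 0 + ZMod.stdAddChar j * F 1 + ZMod.stdAddChar (-j) * F (-1)) := by
    have h := congrFun (LinearEquiv.symm_apply_apply ZMod.dft fun j => (f j : ℂ)) j
    rw [ZMod.invDFT_apply, ← hF] at h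
    rw [← h, smul_eq_mul]
    congr 1
    rw [← Finset.sum_subset (Finset.subset_univ ({0, 1, -1} : Finset (ZMod N)))]
    · rw [Finset.sum_insert (by simp [h01, h0n]), Finset.sum_insert (by simp [h11]),
        Finset.sum_singleton]
      simp [add_assoc]
    · intro k _ hk
      simp only [Finset.mem_insert, Finset.mem_singleton, not_or] at hk
      rw [hf k hk.1 hk.2.1 hk.2.2, smul_zero]
  have hre (j : ZMod N) : ZMod.stdAddChar j =
      (Real.cos (2 * Real.pi * (j.val : ℝ) / N) : ℂ) +
        (Real.sin (2 * Real.pi * (j.val : ℝ) / N) : ℂ) * Complex.I := by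
    rw [ZMod.stdAddChar_apply, ZMod.toCircle_apply, Complex.ofReal_cos, Complex.ofReal_sin,
      ← Complex.exp_mul_I]
    congr 1
    push_cast
    ring
  -- The coefficients are read off from the real part of the inversion formula.
  refine ⟨(N : ℝ)⁻¹ * (F 0).re, (N : ℝ)⁻¹ * ((F 1).re + (F (-1)).re),
    (N : ℝ)⁻¹ * ((F (-1)).im - (F 1).im), fun j => ?_⟩
  have h := key j
  rw [AddChar.map_neg_eq_conj, hre, map_add, map_mul, Complex.conj_ofReal, Complex.conj_ofReal,
    Complex.conj_I] at h
  have hinv : ((N : ℂ)⁻¹) = (((N : ℝ)⁻¹ : ℝ) : ℂ) := by push_cast; rfl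
  rw [hinv] at h
  have h' := congrArg Complex.re h
  simp only [Complex.ofReal_re, Complex.add_re, Complex.mul_re,
    Complex.add_im, Complex.mul_im, Complex.ofReal_im, Complex.I_re, Complex.I_im,
    Complex.neg_re, Complex.neg_im] at h'
  rw [h']
  ring

/-! ### Chords of affinely regular polygons -/

/-- Since `val` wraps around modulo `N`, angles add only up to `q` full turns. The right side splits
the angle into the chord's mid-angle plus its half-angle. -/
theorem exists_two_pi_mul_val_add_div {N : ℕ} [NeZero N] (j : ZMod N) (k : ℕ) :
    ∃ q : ℕ, 2 * Real.pi * ((j + (k : ZMod N)).val : ℝ) / N + q * (2 * Real.pi) =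
      (2 * j.val + k) * (Real.pi / N) + k * (Real.pi / N) := by
  have hN : (N : ℝ) ≠ 0 := NeZero.ne _
  refine ⟨(j.val + k) / N, ?_⟩
  have h1 : (j + (k : ZMod N)).val = (j.val + k) % N := by
    rw [← ZMod.val_natCast, Nat.cast_add, ZMod.natCast_zmod_val]
  have h2 : (((j.val + k) % N : ℕ) : ℝ) + N * ((j.val + k) / N : ℕ) = j.val + k := by
    exact_mod_cast Nat.mod_add_div (j.val + k) N
  rw [h1]
  field_simp
  linear_combination 2 * h2

/-- Squared chord lengths of a polygon inscribed affinely regularly in an ellipse. -/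
theorem dist_sq_eq_of_eq_add_cos_add_sin {N : ℕ} [NeZero N] {V : Type*} [NormedAddCommGroup V]
    [InnerProductSpace ℝ V] {y : ZMod N → V} {c a b : V}
    (hy : ∀ j : ZMod N, y j = c + (Real.cos (2 * Real.pi * (j.val : ℝ) / N) • a +
      Real.sin (2 * Real.pi * (j.val : ℝ) / N) • b)) (j : ZMod N) (k : ℕ) :
    dist (y (j + (k : ZMod N))) (y j) ^ 2 = 4 * Real.sin (k * (Real.pi / N)) ^ 2 *
      (Real.cos ((2 * j.val + k) * (Real.pi / N)) ^ 2 * ‖b‖ ^ 2 -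
        2 * Real.cos ((2 * j.val + k) * (Real.pi / N)) *
          Real.sin ((2 * j.val + k) * (Real.pi / N)) * inner ℝ a b +
        Real.sin ((2 * j.val + k) * (Real.pi / N)) ^ 2 * ‖a‖ ^ 2) := by
  obtain ⟨q, hq⟩ := exists_two_pi_mul_val_add_div j k
  have h0 : 2 * Real.pi * (j.val : ℝ) / N =
      (2 * j.val + k) * (Real.pi / N) - k * (Real.pi / N) := by ring
  set φ := (2 * (j.val : ℝ) + k) * (Real.pi / N)
  set δ := (k : ℝ) * (Real.pi / N)
  have h : y (j + (k : ZMod N)) - y j =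
      (2 * Real.sin δ) • (Real.cos φ • b - Real.sin φ • a) := by
    rw [hy, hy, ← Real.cos_add_nat_mul_two_pi (2 * Real.pi * ((j + (k : ZMod N)).val : ℝ) / N) q,
      ← Real.sin_add_nat_mul_two_pi (2 * Real.pi * ((j + (k : ZMod N)).val : ℝ) / N) q, hq, h0,
      Real.cos_add, Real.cos_sub, Real.sin_add, Real.sin_sub]
    module
  rw [dist_eq_norm, h, norm_smul, mul_pow, Real.norm_eq_abs, sq_abs, norm_sub_sq_real, norm_smul,
    norm_smul, mul_pow, mul_pow, mul_pow, Real.norm_eq_abs, Real.norm_eq_abs, sq_abs, sq_abs,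
    real_inner_smul_left, real_inner_smul_right, real_inner_comm]
  ring

/-- A conic through points at four suitable angles of a circle is that circle. -/
theorem eq_of_quadratic_form_on_angles {A B I S δ μ : ℝ} (h2 : Real.sin (2 * δ) ≠ 0)
    (hμ : Real.sin (2 * (μ - 1) * δ) ≠ 0)
    (h : ∀ x ∈ ({1, 3, μ, μ + 2} : Set ℝ), Real.cos (x * δ) ^ 2 * B -
      2 * Real.cos (x * δ) * Real.sin (x * δ) * I + Real.sin (x * δ) ^ 2 * A = S) :
    A = S ∧ B = S ∧ I = 0 := by
  -- In double angles the form is a constant plus a pure second harmonic. Subtracting its values at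
  -- `x` and `x + 2` gives a linear equation in `(B - A) / 2` and `I`; for `x = 1` and `x = μ` the
  -- determinant is, up to sign, `sin (2 (μ - 1) δ)`.
  have step : ∀ x : ℝ, x ∈ ({1, 3, μ, μ + 2} : Set ℝ) → x + 2 ∈ ({1, 3, μ, μ + 2} : Set ℝ) →
      (B - A) / 2 * Real.sin (2 * (x + 1) * δ) + I * Real.cos (2 * (x + 1) * δ) = 0 := by
    intro x hx hx2
    have e1 := h x hx
    have e2 := h (x + 2) hx2
    have g : ∀ t : ℝ, Real.cos t ^ 2 * B - 2 * Real.cos t * Real.sin t * I +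
        Real.sin t ^ 2 * A = (A + B) / 2 + (B - A) / 2 * Real.cos (2 * t) -
          I * Real.sin (2 * t) := fun t => by
      rw [Real.cos_two_mul, Real.sin_two_mul, Real.sin_sq]
      ring
    rw [g] at e1 e2
    have a1 : 2 * (x * δ) = 2 * (x + 1) * δ - 2 * δ := by ring
    have a2 : 2 * ((x + 2) * δ) = 2 * (x + 1) * δ + 2 * δ := by ring
    rw [a1, Real.cos_sub, Real.sin_sub] at e1
    rw [a2, Real.cos_add, Real.sin_add] at e2
    refine (mul_eq_zero.1 ?_).resolve_left h2
    linear_combination (e1 - e2) / 2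
  have e1 := step 1 (by simp) (by norm_num)
  have e2 := step μ (by simp) (by simp)
  have hd : 2 * (μ - 1) * δ = 2 * (μ + 1) * δ - 2 * (1 + 1) * δ := by ring
  rw [hd, Real.sin_sub] at hμ
  have hP : (B - A) / 2 = 0 := by
    refine (mul_eq_zero.1 ?_).resolve_right hμ
    linear_combination Real.cos (2 * (1 + 1) * δ) * e2 - Real.cos (2 * (μ + 1) * δ) * e1
  have hI : I = 0 := by
    refine (mul_eq_zero.1 ?_).resolve_right hμ
    linear_combination Real.sin (2 * (μ + 1) * δ) * e1 - Real.sin (2 * (1 + 1) * δ) * e2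
  have hS := h 1 (by simp)
  have hAB : B = A := by linarith
  rw [hI, hAB] at hS
  have := Real.sin_sq_add_cos_sq (1 * δ)
  have hA : A = S := by linear_combination hS - A * this
  exact ⟨hA, by rw [hAB, hA], hI⟩

/-! ### Multiplicity of the diagonals -/

/-- The sum of the chords from `j` to `j + m` over all vertices `j` counts each `m`-diagonal
equally often. -/
theorem exists_sum_dist_eq_mul_diagonalSum {N m : ℕ} [NeZero N] (hm : 2 ≤ m) (hmN : 2 * m ≤ N)
    (d : ℕ) : ∃ κ : ℝ, 0 < κ ∧ ∀ y : ZMod N → EuclideanSpace ℝ (Fin d),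
      ∑ j : ZMod N, dist (y (j + (m : ZMod N))) (y j) = κ * diagonalSum m y := by
  classical
  have hseg (y : ZMod N → EuclideanSpace ℝ (Fin d)) (j : ZMod N) :
      dist (y (j + (m : ZMod N))) (y j) = segmentLength y s(j, j + (m : ZMod N)) :=
    dist_comm _ _
  have hm0 : (m : ZMod N) ≠ 0 := fun h => by
    have := Nat.le_of_dvd (by omega) ((ZMod.natCast_eq_zero_iff m N).1 h)
    omega
  -- If `N = 2 m`, each diagonal arises from both of its endpoints, so `κ = 2`; otherwise `κ = 1`.
  by_cases h2 : (m : ZMod N) + m = 0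
  · refine ⟨2, two_pos, fun y => ?_⟩
    simp only [hseg, diagonalSum, mDiagonals]
    rw [Finset.sum_comp (segmentLength y) (fun j : ZMod N => s(j, j + (m : ZMod N))),
      Finset.mul_sum]
    refine Finset.sum_congr rfl fun e he => ?_
    obtain ⟨j, -, rfl⟩ := Finset.mem_image.1 he
    have hfib : ({i | s(i, i + (m : ZMod N)) = s(j, j + (m : ZMod N))} : Finset (ZMod N)) =
        {j, j + (m : ZMod N)} := by
      ext i
      simp only [Finset.mem_filter, Finset.mem_univ, true_and, Sym2.eq_iff, Finset.mem_insert,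
        Finset.mem_singleton]
      constructor
      · rintro (h | h)
        · exact Or.inl h.1
        · exact Or.inr h.1
      · rintro (rfl | rfl)
        · simp
        · exact Or.inr ⟨rfl, by rw [add_assoc, h2, add_zero]⟩
    rw [hfib, Finset.card_pair (by simpa using hm0)]
    simp
  · refine ⟨1, one_pos, fun y => ?_⟩
    simp only [hseg, diagonalSum, mDiagonals, one_mul]
    rw [Finset.sum_image]
    intro i _ j _ hij
    rcases Sym2.eq_iff.1 hij with h | h
    · exact h.1
    · exfalso
      apply h2
      have h3 := h.2
      rw [h.1, add_assoc] at h3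
      simpa using h3

/-! ### Regular polygons, the quadratic bound and its equality case -/

/-- Extend both pairs to orthonormal bases, map one basis to the other, and translate. -/
theorem exists_isometryEquiv_of_orthonormal_pair {d : ℕ}
    {c u v c' u' v' : EuclideanSpace ℝ (Fin d)} (hd : 2 ≤ d)
    (hu : ‖u‖ = 1) (hv : ‖v‖ = 1) (huv : inner ℝ u v = 0)
    (hu' : ‖u'‖ = 1) (hv' : ‖v'‖ = 1) (huv' : inner ℝ u' v' = 0) :
    ∃ T : EuclideanSpace ℝ (Fin d) ≃ᵢ EuclideanSpace ℝ (Fin d),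
      ∀ s t : ℝ, T (c + (s • u + t • v)) = c' + (s • u' + t • v') := by
  obtain ⟨n, rfl⟩ : ∃ n, d = n + 2 := ⟨d - 2, by omega⟩
  have ext (u v : EuclideanSpace ℝ (Fin (n + 2))) (hu : ‖u‖ = 1) (hv : ‖v‖ = 1)
      (huv : inner ℝ u v = 0) :
      ∃ b : OrthonormalBasis (Fin (n + 2)) ℝ (EuclideanSpace ℝ (Fin (n + 2))),
        b 0 = u ∧ b 1 = v := by
    have hvu : inner ℝ v u = 0 := by rw [real_inner_comm, huv]
    obtain ⟨b, hb⟩ := Orthonormal.exists_orthonormalBasis_extension_of_card_eq (𝕜 := ℝ)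
      (E := EuclideanSpace ℝ (Fin (n + 2))) (ι := Fin (n + 2)) (by simp)
      (v := fun i => if i = 0 then u else v) (s := {0, 1}) (by
        refine ⟨?_, ?_⟩
        · rintro ⟨i, rfl | rfl⟩ <;> simp [hu, hv]
        · rintro ⟨i, rfl | rfl⟩ ⟨j, rfl | rfl⟩ hij <;> simp_all)
    exact ⟨b, by simpa using hb 0 (by simp), by simpa using hb 1 (by simp)⟩
  obtain ⟨b, rfl, rfl⟩ := ext u v hu hv huv
  obtain ⟨b', rfl, rfl⟩ := ext u' v' hu' hv' huv'
  let L := b.equiv b' (Equiv.refl _)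
  refine ⟨((IsometryEquiv.subRight c).trans L.toIsometryEquiv).trans (IsometryEquiv.addLeft c'),
    fun s t => ?_⟩
  simp [L]

theorem IsRegularPolygon.dist_add_natCast {N d : ℕ} [NeZero N] {ℓ : ℝ} (hN : 2 ≤ N) (hℓ : 0 < ℓ)
    {y : ZMod N → EuclideanSpace ℝ (Fin d)} (hy : IsRegularPolygon ℓ y) (j : ZMod N) {k : ℕ}
    (hk : k ≤ N) : dist (y (j + (k : ZMod N))) (y j) =
      ℓ * Real.sin (k * (Real.pi / N)) / Real.sin (Real.pi / N) := by
  obtain ⟨c, u, v, hu, hv, huv, hy⟩ := hy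
  have hN' : (2 : ℝ) ≤ N := by exact_mod_cast hN
  have hpi := Real.pi_pos
  have hNs : (N : ℝ) * (Real.pi / N) = Real.pi := by field_simp
  have hs : 0 < Real.pi / N := by positivity
  have hsin : 0 < Real.sin (Real.pi / N) := Real.sin_pos_of_pos_of_lt_pi hs (by nlinarith)
  have hk' : (k : ℝ) ≤ N := by exact_mod_cast hk
  have hsink : 0 ≤ Real.sin (k * (Real.pi / N)) :=
    Real.sin_nonneg_of_nonneg_of_le_pi (by positivity) (by nlinarith)
  have h := dist_sq_eq_of_eq_add_cos_add_sin (c := c) (a := (ℓ / (2 * Real.sin (Real.pi / N))) • u)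
    (b := (ℓ / (2 * Real.sin (Real.pi / N))) • v) (y := y)
    (fun j => by rw [hy j]; module) j k
  rw [real_inner_smul_left, real_inner_smul_right, huv, norm_smul, norm_smul, hu, hv, mul_one,
    Real.norm_eq_abs, sq_abs] at h
  rw [← sq_eq_sq₀ dist_nonneg (by positivity), h]
  have := Real.sin_sq_add_cos_sq ((2 * j.val + k) * (Real.pi / N))
  generalize (2 * (j.val : ℝ) + k) * (Real.pi / N) = φ at this ⊢
  generalize (k : ℝ) * (Real.pi / N) = ψ
  field_simp
  linear_combination 4 * Real.sin ψ ^ 2 * this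

theorem IsEquilateral.sum_dist_sq_le {N d m : ℕ} [NeZero N] {ℓ : ℝ} (hm : 2 ≤ m)
    (hmN : 2 * m ≤ N) {y : ZMod N → EuclideanSpace ℝ (Fin d)} (hy : IsEquilateral ℓ y) :
    Real.sin (Real.pi / N) ^ 2 * ∑ j, dist (y (j + (m : ZMod N))) (y j) ^ 2 ≤
      Real.sin (m * (Real.pi / N)) ^ 2 * (N * ℓ ^ 2) ∧
    (Real.sin (Real.pi / N) ^ 2 * ∑ j, dist (y (j + (m : ZMod N))) (y j) ^ 2 =
      Real.sin (m * (Real.pi / N)) ^ 2 * (N * ℓ ^ 2) →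
      ∃ c a b : EuclideanSpace ℝ (Fin d), ∀ j : ZMod N,
        y j = c + (Real.cos (2 * Real.pi * (j.val : ℝ) / N) • a +
          Real.sin (2 * Real.pi * (j.val : ℝ) / N) • b)) := by
  have hcoord (a : ZMod N) : ∑ j, dist (y (j + a)) (y j) ^ 2 =
      ∑ i, ∑ j, (y (j + a) i - y j i) ^ 2 := by
    rw [Finset.sum_comm]
    refine Finset.sum_congr rfl fun j _ => ?_
    rw [EuclideanSpace.dist_eq, Real.sq_sqrt (Finset.sum_nonneg fun _ _ => sq_nonneg _)]
    refine Finset.sum_congr rfl fun i _ => ?_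
    rw [Real.dist_eq, sq_abs]
  have hedge : N * ℓ ^ 2 = ∑ i, ∑ j, (y (j + 1) i - y j i) ^ 2 := by
    rw [← hcoord, Finset.sum_congr rfl fun j _ => by rw [hy j]]
    simp
  have hterm : ∀ i ∈ Finset.univ,
      Real.sin (Real.pi / N) ^ 2 * ∑ j, (y (j + (m : ZMod N)) i - y j i) ^ 2 ≤
      Real.sin (m * (Real.pi / N)) ^ 2 * ∑ j, (y (j + 1) i - y j i) ^ 2 :=
    fun i _ => (sum_sq_diagonal_le hm hmN fun j => y j i).1
  rw [hcoord, hedge, Finset.mul_sum, Finset.mul_sum]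
  refine ⟨Finset.sum_le_sum hterm, fun heq => ?_⟩
  rw [Finset.sum_eq_sum_iff_of_le hterm] at heq
  have hex (i : Fin d) := exists_eq_add_cos_add_sin (by omega : 3 ≤ N) (fun j => y j i)
    ((sum_sq_diagonal_le hm hmN fun j => y j i).2 (heq i (Finset.mem_univ i)))
  choose c a b h using hex
  refine ⟨WithLp.toLp 2 c, WithLp.toLp 2 a, WithLp.toLp 2 b, fun j => ?_⟩
  ext i
  simpa [add_assoc] using h i j

theorem IsEquilateral.isRegularPolygon {N d m : ℕ} [NeZero N] {ℓ : ℝ} (hℓ : 0 < ℓ) (hm : 2 ≤ m)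
    (hmN : 2 * m ≤ N) {y : ZMod N → EuclideanSpace ℝ (Fin d)} (hy : IsEquilateral ℓ y)
    (hdiag : ∀ j, dist (y (j + (m : ZMod N))) (y j) =
      ℓ * Real.sin (m * (Real.pi / N)) / Real.sin (Real.pi / N)) :
    IsRegularPolygon ℓ y := by
  have hpi := Real.pi_pos
  have hm' : (2 : ℝ) ≤ m := by exact_mod_cast hm
  have hmN' : (2 * m : ℝ) ≤ N := by exact_mod_cast hmN
  have hN' : (0 : ℝ) < N := by linarith
  have hNs : (N : ℝ) * (Real.pi / N) = Real.pi := by field_simp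
  have hs : 0 < Real.pi / N := by positivity
  have hsin : 0 < Real.sin (Real.pi / N) := Real.sin_pos_of_pos_of_lt_pi hs (by nlinarith)
  have hsinm : 0 < Real.sin (m * (Real.pi / N)) :=
    Real.sin_pos_of_pos_of_lt_pi (by positivity) (by nlinarith)
  have hsin2 : 0 < Real.sin (2 * (Real.pi / N)) :=
    Real.sin_pos_of_pos_of_lt_pi (by positivity) (by nlinarith)
  have hsind : 0 < Real.sin (2 * (m - 1) * (Real.pi / N)) :=
    Real.sin_pos_of_pos_of_lt_pi (mul_pos (by linarith) hs) (by nlinarith)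
  obtain ⟨c, a, b, hcab⟩ := (hy.sum_dist_sq_le hm hmN).2 (by
    simp only [hdiag, Finset.sum_const, Finset.card_univ, ZMod.card, nsmul_eq_mul]
    field_simp)
  have hchord := dist_sq_eq_of_eq_add_cos_add_sin hcab
  set R : ℝ := ℓ / (2 * Real.sin (Real.pi / N)) with hR
  have hR0 : 0 < R := by positivity
  have hedge (j : ZMod N) : Real.cos ((2 * j.val + 1) * (Real.pi / N)) ^ 2 * ‖b‖ ^ 2 -
        2 * Real.cos ((2 * j.val + 1) * (Real.pi / N)) *
          Real.sin ((2 * j.val + 1) * (Real.pi / N)) * inner ℝ a b +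
        Real.sin ((2 * j.val + 1) * (Real.pi / N)) ^ 2 * ‖a‖ ^ 2 = R ^ 2 := by
    have h := hchord j 1
    rw [Nat.cast_one, hy j, Nat.cast_one, one_mul] at h
    rw [hR, div_pow, eq_div_iff (by positivity), h]
    ring
  have hd (j : ZMod N) : Real.cos ((2 * j.val + m) * (Real.pi / N)) ^ 2 * ‖b‖ ^ 2 -
        2 * Real.cos ((2 * j.val + m) * (Real.pi / N)) *
          Real.sin ((2 * j.val + m) * (Real.pi / N)) * inner ℝ a b +
        Real.sin ((2 * j.val + m) * (Real.pi / N)) ^ 2 * ‖a‖ ^ 2 = R ^ 2 := by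
    have h := hchord j m
    rw [hdiag j, div_pow, mul_pow] at h
    refine mul_left_cancel₀ (by positivity : 4 * Real.sin (m * (Real.pi / N)) ^ 2 ≠ 0) ?_
    rw [← h, hR]
    field_simp
    norm_num
  have hval1 : ((1 : ZMod N).val : ℝ) = 1 := by
    have : Fact (1 < N) := ⟨by omega⟩
    rw [ZMod.val_one, Nat.cast_one]
  have hval0 : ((0 : ZMod N).val : ℝ) = 0 := by simp
  -- With `δ = π / N` and `μ = m`, the edges at `j = 0, 1` give the angles `δ, 3δ`, and the
  -- `m`-diagonals there give `mδ, (m + 2)δ`.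
  obtain ⟨hA, hB, hI⟩ := eq_of_quadratic_form_on_angles (A := ‖a‖ ^ 2) (B := ‖b‖ ^ 2)
    (I := inner ℝ a b) (S := R ^ 2) hsin2.ne' hsind.ne' (by
      rintro x (rfl | rfl | rfl | rfl)
      · simpa [hval0] using hedge 0
      · have := hedge 1
        rw [hval1] at this
        norm_num at this ⊢
        exact this
      · simpa [hval0] using hd 0
      · have := hd 1
        rw [hval1, mul_one, add_comm (2 : ℝ)] at this
        exact this)
  have hA' : ‖a‖ = R := (sq_eq_sq₀ (norm_nonneg _) hR0.le).1 hA
  have hB' : ‖b‖ = R := (sq_eq_sq₀ (norm_nonneg _) hR0.le).1 hB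
  refine ⟨c, R⁻¹ • a, R⁻¹ • b, ?_, ?_, ?_, fun j => ?_⟩
  · rw [norm_smul, hA', norm_inv, Real.norm_of_nonneg hR0.le, inv_mul_cancel₀ hR0.ne']
  · rw [norm_smul, hB', norm_inv, Real.norm_of_nonneg hR0.le, inv_mul_cancel₀ hR0.ne']
  · rw [real_inner_smul_left, real_inner_smul_right, hI, mul_zero, mul_zero]
  · rw [← hR, hcab j, smul_add, smul_comm R (Real.cos _), smul_comm R (Real.sin _), smul_inv_smul₀ hR0.ne',
      smul_inv_smul₀ hR0.ne']

theorem IsRegularPolygon.areCongruent {N d : ℕ} {ℓ : ℝ} (hd : 2 ≤ d)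
    {y z : ZMod N → EuclideanSpace ℝ (Fin d)} (hy : IsRegularPolygon ℓ y)
    (hz : IsRegularPolygon ℓ z) : AreCongruent y z := by
  obtain ⟨c, u, v, hu, hv, huv, hy⟩ := hy
  obtain ⟨c', u', v', hu', hv', huv', hz⟩ := hz
  obtain ⟨T, hT⟩ := exists_isometryEquiv_of_orthonormal_pair (c := c) (c' := c') hd hu hv huv
    hu' hv' huv'
  refine ⟨T, fun j => ?_⟩
  rw [hy, hz, smul_add, smul_add, smul_smul, smul_smul, hT, smul_smul, smul_smul]

theorem AreCongruent.diagonalSum_eq {N d m : ℕ} [NeZero N]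
    {y z : ZMod N → EuclideanSpace ℝ (Fin d)} (h : AreCongruent y z) :
    diagonalSum m z = diagonalSum m y := by
  obtain ⟨T, hT⟩ := h
  refine Finset.sum_congr rfl fun e _ => ?_
  induction e with
  | h i j =>
    change dist (z i) (z j) = dist (y i) (y j)
    rw [← hT, ← hT, T.dist_eq]

/-- If the mean square of finitely many numbers is at most `D ^ 2`, then their mean is at most
`D`, with equality only if all of them equal `D`. -/
theorem sum_le_card_mul_of_sum_sq_le {ι : Type*} [Fintype ι] {x : ι → ℝ} {D : ℝ} (hD : 0 < D)
    (h : ∑ i, x i ^ 2 ≤ Fintype.card ι * D ^ 2) :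
    ∑ i, x i ≤ Fintype.card ι * D ∧ (∑ i, x i = Fintype.card ι * D → ∀ i, x i = D) := by
  -- Both claims follow from the nonnegativity of this sum of squared deviations from `D`.
  have hsq : ∑ i, (x i - D) ^ 2 = ∑ i, x i ^ 2 - 2 * D * ∑ i, x i + Fintype.card ι * D ^ 2 := by
    simp only [sub_sq, Finset.sum_add_distrib, Finset.sum_sub_distrib, Finset.sum_const,
      Finset.card_univ, nsmul_eq_mul, Finset.mul_sum]
    congr 2
    exact Finset.sum_congr rfl fun i _ => by ring
  have h0 : 0 ≤ ∑ i, (x i - D) ^ 2 := Finset.sum_nonneg fun i _ => sq_nonneg _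
  refine ⟨?_, fun heq i => ?_⟩
  · refine le_of_mul_le_mul_left ?_ hD
    linarith
  · have hz : ∑ i, (x i - D) ^ 2 = 0 := by
      refine le_antisymm ?_ h0
      rw [hsq, heq]
      linarith
    rw [Finset.sum_eq_zero_iff_of_nonneg fun i _ => sq_nonneg _] at hz
    have := hz i (Finset.mem_univ i)
    exact sub_eq_zero.1 (pow_eq_zero_iff two_ne_zero |>.1 this)

/-! ### The maximum property -/

theorem theorem2 (N d m : ℕ) [NeZero N] (hd : 2 ≤ d) (hm : 2 ≤ m) (hmN : m ≤ N / 2)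
    (ℓ : ℝ) (hℓ : 0 < ℓ)
    (yreg : ZMod N → EuclideanSpace ℝ (Fin d)) (hreg : IsRegularPolygon ℓ yreg) :
    IsEquilateral ℓ yreg ∧
      ∀ᶠ y in 𝓝 yreg, IsEquilateral ℓ y →
        diagonalSum m y ≤ diagonalSum m yreg ∧
          (diagonalSum m y = diagonalSum m yreg ↔ AreCongruent yreg y) := by
  have hmN2 : 2 * m ≤ N := by omega
  have hpi := Real.pi_pos
  have hm' : (2 : ℝ) ≤ m := by exact_mod_cast hm
  have hmN' : (2 * m : ℝ) ≤ N := by exact_mod_cast hmN2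
  have hN' : (0 : ℝ) < N := by linarith
  have hNs : (N : ℝ) * (Real.pi / N) = Real.pi := by field_simp
  have hs : 0 < Real.pi / N := by positivity
  have hsin : 0 < Real.sin (Real.pi / N) := Real.sin_pos_of_pos_of_lt_pi hs (by nlinarith)
  have hsinm : 0 < Real.sin (m * (Real.pi / N)) :=
    Real.sin_pos_of_pos_of_lt_pi (by positivity) (by nlinarith)
  have hchord (j : ZMod N) {k : ℕ} (hk : k ≤ N) :=
    hreg.dist_add_natCast (by omega) hℓ j hk
  -- The whole space serves as the neighbourhood.
  refine ⟨fun j => ?_, Filter.Eventually.of_forall fun y hy => ?_⟩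
  · have := hchord j (by omega : 1 ≤ N)
    rwa [Nat.cast_one, Nat.cast_one, one_mul, mul_div_cancel_right₀ _ hsin.ne'] at this
  set D : ℝ := ℓ * Real.sin (m * (Real.pi / N)) / Real.sin (Real.pi / N) with hD
  have hD0 : 0 < D := by positivity
  obtain ⟨κ, hκ, hsum⟩ := exists_sum_dist_eq_mul_diagonalSum hm hmN2 d
  have hreg_sum : κ * diagonalSum m yreg = N * D := by
    rw [← hsum, Finset.sum_congr rfl fun j _ => hchord j (by omega : m ≤ N)]
    simp [hD]
  have hsq : ∑ j, dist (y (j + (m : ZMod N))) (y j) ^ 2 ≤ Fintype.card (ZMod N) * D ^ 2 := by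
    have h := (hy.sum_dist_sq_le hm hmN2).1
    rw [ZMod.card, hD, div_pow, ← mul_div_assoc, le_div_iff₀ (by positivity)]
    linarith
  have hmain := sum_le_card_mul_of_sum_sq_le hD0 hsq
  rw [hsum, ZMod.card, ← hreg_sum] at hmain
  refine ⟨le_of_mul_le_mul_left hmain.1 hκ, fun heq => ?_, fun h => h.diagonalSum_eq⟩
  exact hreg.areCongruent hd
    (hy.isRegularPolygon hℓ hm hmN2 (hmain.2 (by rw [heq])))
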